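/- The logic MTL has formulas built from denumerably many propositional variables with the connectives $\&,\wedge,\to$ (binary) and $\bot$ (nullary), the axioms (for all formulas $\varphi,\psi,\chi$) $(\varphi\to\psi)\to((\psi\to\chi)\to(\varphi\to\chi))$, $(\varphi\&\psi)\to\varphi$, $(\varphi\&\psi)\to(\psi\&\varphi)$, $(\varphi\wedge\psi)\to\varphi$, $(\varphi\wedge\psi)\to(\psi\wedge\varphi)$, $(\varphi\&(\varphi\to\psi))\to(\psi\wedge\varphi)$, $(\varphi\to(\psi\to\chi))\to((\varphi\&\psi)\to\chi)$, $((\varphi\&\psi)\to\chi)\to(\varphi\to(\psi\to\chi))$, $((\varphi\to\psi)\to\chi)\to(((\psi\to\varphi)\to\chi)\to\chi)$, $\bot\to\varphi$, and modus ponens as its only rule. An axiomatic extension $L$ of MTL is obtained by adding a set of axiom schemes (closed under substitution). Put $\varphi^1=\varphi$, $\varphi^{k+1}=\varphi^k\&\varphi$; for $n\ge 1$, $L$ is called $n$-contractive if $\vdash_L\varphi^n\to\varphi^{n+1}$ for every formula $\varphi$. An MTL-algebra is an algebra $\langle A,*,\Rightarrow,\sqcap,\sqcup,0,1\rangle$ such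 that $\langle A,\sqcap,\sqcup,0,1\rangle$ is a lattice with minimum $0$ and maximum $1$, $\langle A,*,1\rangle$ is a commutative monoid, $z*x\le y$ iff $z\le x\Rightarrow y$, and $(x\Rightarrow y)\sqcup(y\Rightarrow x)=1$ for all $x,y,z\in A$. A formula is valid in $A$ if it takes the value $1$ under every assignment of its variables in $A$, where $\&,\wedge,\to,\bot$ are interpreted by $*,\sqcap,\Rightarrow,0$. An $L$-algebra is an MTL-algebra in which all the additional axioms of $L$ are valid; an $L$-chain is a totally ordered $L$-algebra. **Theorem.** Let $n\ge 1$ and let $L$ be an $n$-contractive axiomatic extension of MTL. The following are equivalent. 1. $L$ enjoys the single chain completeness (SCC): there is an $L$-chain $A$ such that $L$ is complete with respect to $A$, i.e. for every formula $\varphi$, $\vdash_L\varphi$ if and only if $\varphi$ is valid in $A$. 2. $L$ enjoys the subdirect single chain completeness (subSCC): there is a subdirectly irreducible $L$-algebra that is generic, i.e. generates the variety of all $L$-algebras. Here an algebra is subdirectly irreducible if it is trivial or has a least congruence among those different from the identity. -/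

import Mathlib

universe u v

namespace MTL

/-! ### Syntax -/

/-- Formulas over the connectives `&`, `∧`, `→`, `⊥` and denumerably many variables. -/
inductive Formula : Type
  | var : ℕ → Formula
  | bot : Formula
  | conj : Formula → Formula → Formula
  | meet : Formula → Formula → Formula
  | imp : Formula → Formula → Formula

namespace Formula

/-- Truth constant `⊥ → ⊥`, used only as the zeroth power. -/
def top : Formula := imp bot bot

/-- Powers with respect to the strong conjunction: `φ¹ = φ`, `φᵏ⁺¹ = φᵏ & φ`. -/
def pow (φ : Formula) : ℕ → Formula
  | 0 => top
  | 1 => φ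
  | k + 2 => conj (pow φ (k + 1)) φ

/-- Simultaneous substitution of formulas for variables. -/
def subst (σ : ℕ → Formula) : Formula → Formula
  | var i => σ i
  | bot => bot
  | conj φ ψ => conj (subst σ φ) (subst σ ψ)
  | meet φ ψ => meet (subst σ φ) (subst σ ψ)
  | imp φ ψ => imp (subst σ φ) (subst σ ψ)

end Formula

open Formula in
/-- The axioms of MTL (all instances). -/
inductive BaseRule : Formula → Prop
  | a1 (φ ψ χ : Formula) : BaseRule (imp (imp φ ψ) (imp (imp ψ χ) (imp φ χ)))
  | a2 (φ ψ : Formula) : BaseRule (imp (conj φ ψ) φ)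
  | a3 (φ ψ : Formula) : BaseRule (imp (conj φ ψ) (conj ψ φ))
  | a4 (φ ψ : Formula) : BaseRule (imp (meet φ ψ) φ)
  | a5 (φ ψ : Formula) : BaseRule (imp (meet φ ψ) (meet ψ φ))
  | a6 (φ ψ : Formula) : BaseRule (imp (conj φ (imp φ ψ)) (meet ψ φ))
  | a7a (φ ψ χ : Formula) : BaseRule (imp (imp φ (imp ψ χ)) (imp (conj φ ψ) χ))
  | a7b (φ ψ χ : Formula) : BaseRule (imp (imp (conj φ ψ) χ) (imp φ (imp ψ χ)))
  | a8 (φ ψ χ : Formula) :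
      BaseRule (imp (imp (imp φ ψ) χ) (imp (imp (imp ψ φ) χ) χ))
  | a9 (φ : Formula) : BaseRule (imp bot φ)

/-- An axiomatic extension of MTL, presented by the set of its additional axiom schemes
(the formulas in `schemes` and all their substitution instances are the new axioms). -/
structure Extension : Type where
  schemes : Set Formula

/-- `Derives L Γ φ`: there is a proof of `φ` from the theory `Γ` in `L`. -/
inductive Derives (L : Extension) (Γ : Set Formula) : Formula → Prop
  | hyp {φ : Formula} : φ ∈ Γ → Derives L Γ φ
  | base {φ : Formula} : BaseRule φ → Derives L Γ φ
  | scheme {φ : Formula} (σ : ℕ → Formula) : φ ∈ L.schemes → Derives L Γ (φ.subst σ)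
  | mp {φ ψ : Formula} : Derives L Γ φ → Derives L Γ (Formula.imp φ ψ) → Derives L Γ ψ

/-- `φ` is a theorem of `L`. -/
def Provable (L : Extension) (φ : Formula) : Prop := Derives L ∅ φ

/-- `L` proves `φⁿ → φⁿ⁺¹` for every formula `φ`. -/
def Contractive (L : Extension) (n : ℕ) : Prop :=
  ∀ φ : Formula, Provable L (Formula.imp (φ.pow n) (φ.pow (n + 1)))

/-! ### Semantics -/

/-- FL_ew-algebras: bounded lattices (with `⊤ = 1`) that are commutative monoids, with a residual
`⇨` of the monoid operation. -/
class FLewAlgebra (A : Type u) extends Lattice A, BoundedOrder A, CommMonoid A, HImp A where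
  top_eq_one : (⊤ : A) = 1
  residuation : ∀ x y z : A, z * x ≤ y ↔ z ≤ x ⇨ y

/-- MTL-algebras: prelinear FL_ew-algebras. -/
class MTLAlgebra (A : Type u) extends FLewAlgebra A where
  prelinearity : ∀ x y : A, (x ⇨ y) ⊔ (y ⇨ x) = 1

/-- The value of a formula under an assignment of its variables. -/
def eval {A : Type u} [MTLAlgebra A] (e : ℕ → A) : Formula → A
  | .var i => e i
  | .bot => ⊥
  | .conj φ ψ => eval e φ * eval e ψ
  | .meet φ ψ => eval e φ ⊓ eval e ψ
  | .imp φ ψ => eval e φ ⇨ eval e ψ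

/-- `φ` is valid in `A`. -/
def Valid (A : Type u) [MTLAlgebra A] (φ : Formula) : Prop :=
  ∀ e : ℕ → A, eval e φ = 1

/-- The identity `φ ≈ ψ` holds in `A`. Since `⊔` and `1` are term-definable from the other
operations in MTL-algebras, formulas represent all terms in the signature of MTL-algebras. -/
def SatisfiesIdentity (A : Type u) [MTLAlgebra A] (φ ψ : Formula) : Prop :=
  ∀ e : ℕ → A, eval e φ = eval e ψ

/-- `A` belongs to the variety corresponding to `L`. -/
def IsAlgebraOf (L : Extension) (A : Type u) [MTLAlgebra A] : Prop :=
  ∀ φ ∈ L.schemes, Valid A φ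

/-- `A` is totally ordered. -/
def IsChain (A : Type u) [MTLAlgebra A] : Prop :=
  ∀ x y : A, x ≤ y ∨ y ≤ x

/-- `L` is complete with respect to `A`. -/
def CompleteWrt (L : Extension) (A : Type u) [MTLAlgebra A] : Prop :=
  ∀ φ : Formula, Provable L φ ↔ Valid A φ

/-- `B` belongs to the variety (equational class) generated by `A`: it satisfies all the
identities of `A`. -/
def InVarietyGeneratedBy (A : Type u) [MTLAlgebra A] (B : Type u) [MTLAlgebra B] : Prop :=
  ∀ φ ψ : Formula, SatisfiesIdentity A φ ψ → SatisfiesIdentity B φ ψ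

/-- `A` is generic for `L`: the variety generated by `A` is the variety of all `L`-algebras. -/
def IsGeneric (L : Extension) (A : Type u) [MTLAlgebra A] : Prop :=
  ∀ (B : Type u) [MTLAlgebra B], InVarietyGeneratedBy A B ↔ IsAlgebraOf L B

/-- Congruences of an MTL-algebra: equivalence relations compatible with all operations. -/
structure Congruence (A : Type u) [MTLAlgebra A] extends Setoid A where
  mul : ∀ {a b c d : A}, r a b → r c d → r (a * c) (b * d)
  himp : ∀ {a b c d : A}, r a b → r c d → r (a ⇨ c) (b ⇨ d)
  inf : ∀ {a b c d : A}, r a b → r c d → r (a ⊓ c) (b ⊓ d)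
  sup : ∀ {a b c d : A}, r a b → r c d → r (a ⊔ c) (b ⊔ d)

/-- The congruence differs from the identity relation. -/
def Congruence.Nontrivial {A : Type u} [MTLAlgebra A] (θ : Congruence A) : Prop :=
  ∃ x y : A, θ.r x y ∧ x ≠ y

/-- `A` is subdirectly irreducible: it is trivial or has a least congruence among those different
from the identity. (The trivial algebra matters for the inconsistent logic only, since it is not
generic for any other one.) -/
def SubdirectlyIrreducible (A : Type u) [MTLAlgebra A] : Prop :=
  Subsingleton A ∨
    ∃ μ : Congruence A, μ.Nontrivial ∧
      ∀ θ : Congruence A, θ.Nontrivial → ∀ x y : A, μ.r x y → θ.r x y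

/-- Single chain completeness: `L` is complete with respect to some `L`-chain. -/
def SCC (L : Extension) : Prop :=
  ∃ (A : Type u) (_ : MTLAlgebra A), IsAlgebraOf L A ∧ IsChain A ∧ CompleteWrt L A

/-- Subdirect single chain completeness: there is a generic subdirectly irreducible
`L`-algebra. -/
def SubSCC (L : Extension) : Prop :=
  ∃ (A : Type u) (_ : MTLAlgebra A),
    IsAlgebraOf L A ∧ SubdirectlyIrreducible A ∧ IsGeneric L A

end MTL

namespace MTL

open Formula

/-! ### Arithmetic of MTL-algebras -/

section Algebra

variable {A : Type u} [MTLAlgebra A]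

/-! From a complete chain to a subdirectly irreducible generic algebra: for every unprovable `φ`,
take a copy `φ'` in fresh variables and the axiom `φ' → p`, with `p` one new variable. A derivation
of `p` uses finitely many of these; the chain refutes those `φ'` simultaneously, and the largest of
their values, still below `1`, can be given to `p`. So `p` is not derivable
(`not_derives_var_zero`). Extend to a theory maximal for not deriving `p`. Every nontrivial
congruence of its Lindenbaum algebra collapses `p` to `1`, which gives subdirect irreducibility, and
no unprovable `φ` is valid there, since `φ'` would yield `p`.

Conversely, prelinearity makes a subdirectly irreducible algebra a chain
(`SubdirectlyIrreducible.isChain`), and generic algebras are complete. To land in an arbitrary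
universe, the chain is replaced by the Lindenbaum algebra of the formulas true under one assignment
that refutes all unprovable formulas at once. -/

theorem le_one' (a : A) : a ≤ 1 := FLewAlgebra.top_eq_one (A := A) ▸ le_top

theorem mul_le_iff_le_himp {a b c : A} : a * b ≤ c ↔ a ≤ b ⇨ c :=
  FLewAlgebra.residuation b c a

theorem himp_eq_one_iff {a b : A} : a ⇨ b = 1 ↔ a ≤ b := by
  rw [← one_mul a, mul_le_iff_le_himp, one_mul]
  exact ⟨fun h => h.ge, fun h => le_antisymm (le_one' _) h⟩

theorem one_himp' (a : A) : (1 : A) ⇨ a = a :=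
  le_antisymm (by rw [← mul_one ((1 : A) ⇨ a), mul_le_iff_le_himp])
    (by rw [← mul_le_iff_le_himp, mul_one])

theorem himp_mul_le (a b : A) : (a ⇨ b) * a ≤ b := mul_le_iff_le_himp.2 le_rfl

theorem mul_mono_left' {a b : A} (h : a ≤ b) (c : A) : a * c ≤ b * c :=
  mul_le_iff_le_himp.2 (h.trans (mul_le_iff_le_himp.1 le_rfl))

theorem mul_mono' {a b c d : A} (h : a ≤ b) (h' : c ≤ d) : a * c ≤ b * d := by
  refine (mul_mono_left' h c).trans ?_
  rw [mul_comm b c, mul_comm b d]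
  exact mul_mono_left' h' b

theorem mul_le_left' (a b : A) : a * b ≤ a := by
  simpa using mul_mono' (le_refl a) (le_one' b)

theorem mul_le_right' (a b : A) : a * b ≤ b := by
  simpa using mul_mono' (le_one' a) (le_refl b)

/-- By residuation `a` and `b` both lie below `d ⇨ c`, hence so does their join `1`. -/
theorem le_of_sup_eq_one {a b c d : A} (h : a ⊔ b = 1) (ha : a * d ≤ c) (hb : b * d ≤ c) :
    d ≤ c := by
  rw [← one_mul d, ← h, mul_le_iff_le_himp]
  exact sup_le (mul_le_iff_le_himp.1 ha) (mul_le_iff_le_himp.1 hb)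

/-- Inductively, `b = 1 * b = (a ⊔ b ^ k) * b ≤ a ⊔ b ^ (k + 1)`, so `1 = a ⊔ b` lies below the
right side too. -/
theorem sup_pow_eq_one {a b : A} (h : a ⊔ b = 1) (k : ℕ) : a ⊔ b ^ k = 1 := by
  induction k with
  | zero => rw [pow_zero]; exact sup_eq_right.2 (le_one' a)
  | succ k ih =>
    refine le_antisymm (le_one' _) (le_of_sup_eq_one h ?_ ?_)
    · exact (mul_le_left' _ _).trans le_sup_left
    · rw [mul_one]
      rw [← one_mul b]
      refine le_of_sup_eq_one ih ((mul_le_left' _ _).trans le_sup_left) ?_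
      rw [one_mul, ← pow_succ]
      exact le_sup_right

theorem pow_sup_pow_eq_one {a b : A} (h : a ⊔ b = 1) (k m : ℕ) : a ^ k ⊔ b ^ m = 1 := by
  have := sup_pow_eq_one h m
  rw [sup_comm] at this ⊢
  exact sup_pow_eq_one this k

/-! ### Congruences -/

/-- The congruence of the filter generated by `a`: `x` and `y` are identified when both residuals lie above a power
of `a`. -/
def principalCongruence (a : A) : Congruence A where
  r x y := (∃ k : ℕ, a ^ k ≤ x ⇨ y) ∧ ∃ k : ℕ, a ^ k ≤ y ⇨ x
  iseqv := by
    have htrans : ∀ {x y z : A}, (∃ k : ℕ, a ^ k ≤ x ⇨ y) → (∃ k : ℕ, a ^ k ≤ y ⇨ z) →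
        ∃ k : ℕ, a ^ k ≤ x ⇨ z := by
      rintro x y z ⟨k, hk⟩ ⟨m, hm⟩
      refine ⟨m + k, ?_⟩
      rw [pow_add, ← mul_le_iff_le_himp, mul_assoc]
      exact (mul_mono' hm (mul_le_iff_le_himp.2 hk)).trans (himp_mul_le _ _)
    refine ⟨fun x => ?_, fun h => ⟨h.2, h.1⟩, fun h h' => ⟨htrans h.1 h'.1, htrans h'.2 h.2⟩⟩
    have : a ^ 0 ≤ x ⇨ x := by rw [himp_eq_one_iff.2 le_rfl, pow_zero]
    exact ⟨⟨0, this⟩, ⟨0, this⟩⟩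
  mul := by
    have key : ∀ {x y z w : A}, (∃ k : ℕ, a ^ k ≤ x ⇨ y) → (∃ k : ℕ, a ^ k ≤ z ⇨ w) →
        ∃ k : ℕ, a ^ k ≤ x * z ⇨ y * w := by
      rintro x y z w ⟨k, hk⟩ ⟨m, hm⟩
      refine ⟨k + m, ?_⟩
      rw [pow_add, ← mul_le_iff_le_himp, mul_mul_mul_comm]
      exact mul_mono' (mul_le_iff_le_himp.2 hk) (mul_le_iff_le_himp.2 hm)
    exact @fun _ _ _ _ h h' => ⟨key h.1 h'.1, key h.2 h'.2⟩
  himp := by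
    have key : ∀ {x y z w : A}, (∃ k : ℕ, a ^ k ≤ y ⇨ x) → (∃ k : ℕ, a ^ k ≤ z ⇨ w) →
        ∃ k : ℕ, a ^ k ≤ (x ⇨ z) ⇨ (y ⇨ w) := by
      rintro x y z w ⟨k, hk⟩ ⟨m, hm⟩
      refine ⟨m + k, ?_⟩
      rw [← mul_le_iff_le_himp, ← mul_le_iff_le_himp, pow_add]
      calc a ^ m * a ^ k * (x ⇨ z) * y = a ^ m * ((x ⇨ z) * (a ^ k * y)) := by
            simp only [mul_assoc, mul_left_comm]
        _ ≤ a ^ m * ((x ⇨ z) * x) :=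
            mul_mono' le_rfl (mul_mono' le_rfl (mul_le_iff_le_himp.2 hk))
        _ ≤ a ^ m * z := mul_mono' le_rfl (himp_mul_le _ _)
        _ ≤ w := mul_le_iff_le_himp.2 hm
    exact @fun _ _ _ _ h h' => ⟨key h.2 h'.1, key h.1 h'.2⟩
  inf := by
    have key : ∀ {x y z w : A}, (∃ k : ℕ, a ^ k ≤ x ⇨ y) → (∃ k : ℕ, a ^ k ≤ z ⇨ w) →
        ∃ k : ℕ, a ^ k ≤ x ⊓ z ⇨ y ⊓ w := by
      rintro x y z w ⟨k, hk⟩ ⟨m, hm⟩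
      refine ⟨k + m, ?_⟩
      rw [pow_add, ← mul_le_iff_le_himp]
      exact le_inf
        ((mul_mono' (mul_le_left' _ _) inf_le_left).trans (mul_le_iff_le_himp.2 hk))
        ((mul_mono' (mul_le_right' _ _) inf_le_right).trans (mul_le_iff_le_himp.2 hm))
    exact @fun _ _ _ _ h h' => ⟨key h.1 h'.1, key h.2 h'.2⟩
  sup := by
    have key : ∀ {x y z w : A}, (∃ k : ℕ, a ^ k ≤ x ⇨ y) → (∃ k : ℕ, a ^ k ≤ z ⇨ w) →
        ∃ k : ℕ, a ^ k ≤ x ⊔ z ⇨ y ⊔ w := by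
      rintro x y z w ⟨k, hk⟩ ⟨m, hm⟩
      refine ⟨k + m, ?_⟩
      rw [pow_add, ← mul_le_iff_le_himp, mul_comm, mul_le_iff_le_himp]
      refine sup_le ?_ ?_ <;> rw [← mul_le_iff_le_himp, mul_comm]
      · exact ((mul_mono_left' (mul_le_left' _ _) _).trans
          (mul_le_iff_le_himp.2 hk)).trans le_sup_left
      · exact ((mul_mono_left' (mul_le_right' _ _) _).trans
          (mul_le_iff_le_himp.2 hm)).trans le_sup_right
    exact @fun _ _ _ _ h h' => ⟨key h.1 h'.1, key h.2 h'.2⟩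

theorem principalCongruence_nontrivial {a : A} (ha : a ≠ 1) :
    (principalCongruence a).Nontrivial := by
  refine ⟨a, 1, ⟨⟨0, ?_⟩, ⟨1, ?_⟩⟩, ha⟩
  · rw [himp_eq_one_iff.2 (le_one' a), pow_zero]
  · rw [one_himp', pow_one]

/-- If neither residual is `1`, both generate nontrivial congruences, and these share a pair `u ≠ v`
of the monolith. Powers of both residuals then lie below `u ⇨ v` and `v ⇨ u`; such powers still join
to `1`, which forces `u = v`. -/
theorem SubdirectlyIrreducible.isChain (h : SubdirectlyIrreducible A) : IsChain A := by
  intro x y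
  rcases h with h | ⟨μ, ⟨u, v, huv, hne⟩, hμ⟩
  · exact Or.inl (Subsingleton.elim x y).le
  rw [← himp_eq_one_iff, ← himp_eq_one_iff (a := y)]
  by_contra! hxy
  obtain ⟨⟨k, hk⟩, ⟨k', hk'⟩⟩ := hμ _ (principalCongruence_nontrivial hxy.1) u v huv
  obtain ⟨⟨m, hm⟩, ⟨m', hm'⟩⟩ := hμ _ (principalCongruence_nontrivial hxy.2) u v huv
  have hpre := MTLAlgebra.prelinearity x y
  refine hne (le_antisymm ?_ ?_) <;> rw [← himp_eq_one_iff] <;>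
    refine le_antisymm (le_one' _) ?_
  · exact (pow_sup_pow_eq_one hpre k m).ge.trans (sup_le hk hm)
  · exact (pow_sup_pow_eq_one hpre k' m').ge.trans (sup_le hk' hm')

variable (A) in
/-- The intersection of all congruences different from the identity. -/
def monolith : Congruence A where
  r x y := ∀ θ : Congruence A, θ.Nontrivial → θ.r x y
  iseqv := ⟨fun x θ _ => θ.iseqv.refl x, fun h θ hθ => θ.iseqv.symm (h θ hθ),
    fun h h' θ hθ => θ.iseqv.trans (h θ hθ) (h' θ hθ)⟩
  mul h h' θ hθ := θ.mul (h θ hθ) (h' θ hθ)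
  himp h h' θ hθ := θ.himp (h θ hθ) (h' θ hθ)
  inf h h' θ hθ := θ.inf (h θ hθ) (h' θ hθ)
  sup h h' θ hθ := θ.sup (h θ hθ) (h' θ hθ)

/-- An element different from `1` that every nontrivial congruence identifies with `1` witnesses
subdirect irreducibility. -/
theorem subdirectlyIrreducible_of_forall_rel_one {a : A} (ha : a ≠ 1)
    (h : ∀ θ : Congruence A, θ.Nontrivial → θ.r a 1) : SubdirectlyIrreducible A :=
  Or.inr ⟨monolith A, ⟨a, 1, h, ha⟩, fun θ hθ _ _ hxy => hxy θ hθ⟩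

/-- If `x` and `y` are identified, both residuals are identified with `1`; they are not both equal
to `1` unless `x = y`. -/
theorem Congruence.Nontrivial.exists_rel_one {θ : Congruence A} (hθ : θ.Nontrivial) :
    ∃ z : A, z ≠ 1 ∧ θ.r z 1 := by
  obtain ⟨x, y, hxy, hne⟩ := hθ
  have h1 : θ.r (x ⇨ y) 1 := by
    have := θ.himp hxy (θ.iseqv.refl y)
    rwa [himp_eq_one_iff.2 (le_refl y)] at this
  have h2 : θ.r (y ⇨ x) 1 := by
    have := θ.himp (θ.iseqv.symm hxy) (θ.iseqv.refl x)
    rwa [himp_eq_one_iff.2 (le_refl x)] at this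
  by_contra! H
  exact hne (le_antisymm (himp_eq_one_iff.1 (not_not.1 fun h => H _ h h1))
    (himp_eq_one_iff.1 (not_not.1 fun h => H _ h h2)))

/-! ### Soundness -/

theorem eval_top (e : ℕ → A) : eval e Formula.top = 1 := himp_eq_one_iff.2 le_rfl

theorem eval_subst (e : ℕ → A) (σ : ℕ → Formula) (φ : Formula) :
    eval e (φ.subst σ) = eval (fun i => eval e (σ i)) φ := by
  induction φ with
  | var i => rfl
  | bot => rfl
  | conj φ ψ h h' => simp only [subst, eval, h, h']
  | meet φ ψ h h' => simp only [subst, eval, h, h']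
  | imp φ ψ h h' => simp only [subst, eval, h, h']

theorem BaseRule.eval_eq_one {φ : Formula} (h : BaseRule φ) (e : ℕ → A) : eval e φ = 1 := by
  cases h with
  | a1 φ ψ χ =>
    simp only [eval, himp_eq_one_iff, ← mul_le_iff_le_himp]
    rw [mul_comm (_ ⇨ _), mul_assoc]
    exact (mul_mono' le_rfl (himp_mul_le _ _)).trans (himp_mul_le _ _)
  | a2 φ ψ => exact himp_eq_one_iff.2 (mul_le_left' _ _)
  | a3 φ ψ => exact himp_eq_one_iff.2 (mul_comm _ _).le
  | a4 φ ψ => exact himp_eq_one_iff.2 inf_le_left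
  | a5 φ ψ => exact himp_eq_one_iff.2 (inf_comm (eval e φ) (eval e ψ)).le
  | a6 φ ψ =>
    refine himp_eq_one_iff.2 (le_inf ?_ (mul_le_left' _ _))
    rw [eval, mul_comm]
    exact himp_mul_le _ _
  | a7a φ ψ χ =>
    simp only [eval, himp_eq_one_iff, ← mul_le_iff_le_himp]
    rw [← mul_assoc]
    exact (mul_mono_left' (himp_mul_le _ _) _).trans (himp_mul_le _ _)
  | a7b φ ψ χ =>
    simp only [eval, himp_eq_one_iff, ← mul_le_iff_le_himp]
    rw [mul_assoc]
    exact himp_mul_le _ _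
  | a8 φ ψ χ =>
    simp only [eval, himp_eq_one_iff, ← mul_le_iff_le_himp]
    refine le_of_sup_eq_one (MTLAlgebra.prelinearity (eval e φ) (eval e ψ)) ?_ ?_
    · rw [mul_comm]
      exact (mul_mono_left' (mul_le_left' _ _) _).trans (himp_mul_le _ _)
    · rw [mul_comm]
      exact (mul_mono_left' (mul_le_right' _ _) _).trans (himp_mul_le _ _)
  | a9 φ => exact himp_eq_one_iff.2 bot_le

/-- The hypotheses need to hold only at the given assignment, because they are never substituted
into; the schemes are. -/
theorem Derives.eval_eq_one {L : Extension} (hA : IsAlgebraOf L A) {Γ : Set Formula}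
    {e : ℕ → A} (hΓ : ∀ φ ∈ Γ, eval e φ = 1) {φ : Formula} (h : Derives L Γ φ) :
    eval e φ = 1 := by
  induction h with
  | hyp h => exact hΓ _ h
  | base h => exact h.eval_eq_one e
  | scheme σ h => rw [eval_subst]; exact hA _ h _
  | mp _ _ h h' => rwa [eval, h, one_himp'] at h'

theorem Provable.valid {L : Extension} {φ : Formula} (h : Provable L φ)
    (hA : IsAlgebraOf L A) : Valid A φ :=
  fun _ => Derives.eval_eq_one hA (fun _ h => h.elim) h

end Algebra

/-! ### Derivations -/

namespace Derives

variable {L : Extension} {Γ Δ : Set Formula} {φ ψ χ ξ : Formula}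

theorem mono (hΓ : Γ ⊆ Δ) (h : Derives L Γ φ) : Derives L Δ φ := by
  induction h with
  | hyp h => exact .hyp (hΓ h)
  | base h => exact .base h
  | scheme σ h => exact .scheme σ h
  | mp _ _ h h' => exact .mp h h'

/-- Derivations are finitary. -/
theorem exists_mem_of_sUnion {c : Set (Set Formula)} (hne : c.Nonempty)
    (hc : DirectedOn (· ⊆ ·) c) (h : Derives L (⋃₀ c) φ) : ∃ S ∈ c, Derives L S φ := by
  obtain ⟨S₀, hS₀⟩ := hne
  induction h with
  | hyp h =>
    obtain ⟨S, hS, h⟩ := h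
    exact ⟨S, hS, .hyp h⟩
  | base h => exact ⟨S₀, hS₀, .base h⟩
  | scheme σ h => exact ⟨S₀, hS₀, .scheme σ h⟩
  | mp _ _ h h' =>
    obtain ⟨S, hS, h⟩ := h
    obtain ⟨S', hS', h'⟩ := h'
    obtain ⟨U, hU, hSU, hSU'⟩ := hc S hS S' hS'
    exact ⟨U, hU, .mp (h.mono hSU) (h'.mono hSU')⟩

theorem exists_finite (h : Derives L Γ φ) : ∃ S ⊆ Γ, S.Finite ∧ Derives L S φ := by
  have hU : ⋃₀ {S | S ⊆ Γ ∧ S.Finite} = Γ := by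
    refine Set.Subset.antisymm (Set.sUnion_subset fun S hS => hS.1) fun ψ hψ => ?_
    exact ⟨{ψ}, ⟨Set.singleton_subset_iff.2 hψ, Set.finite_singleton ψ⟩, rfl⟩
  rw [← hU] at h
  obtain ⟨S, hS, h⟩ := exists_mem_of_sUnion (c := {S | S ⊆ Γ ∧ S.Finite})
    ⟨∅, Set.empty_subset Γ, Set.finite_empty⟩
    (fun S hS S' hS' => ⟨S ∪ S', ⟨Set.union_subset hS.1 hS'.1, hS.2.union hS'.2⟩,
      Set.subset_union_left, Set.subset_union_right⟩) h
  exact ⟨S, hS.1, hS.2, h⟩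

/-! ### Derived rules of MTL -/

theorem trans (h : Derives L Γ (imp φ ψ)) (h' : Derives L Γ (imp ψ χ)) :
    Derives L Γ (imp φ χ) :=
  .mp h' (.mp h (.base (.a1 φ ψ χ)))

theorem conj_imp_iff : Derives L Γ (imp (conj φ ψ) χ) ↔ Derives L Γ (imp φ (imp ψ χ)) :=
  ⟨fun h => .mp h (.base (.a7b φ ψ χ)), fun h => .mp h (.base (.a7a φ ψ χ))⟩

theorem exchange (h : Derives L Γ (imp φ (imp ψ χ))) : Derives L Γ (imp ψ (imp φ χ)) :=
  conj_imp_iff.1 ((Derives.base (.a3 ψ φ)).trans (conj_imp_iff.2 h))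

theorem weaken (h : Derives L Γ φ) : Derives L Γ (imp ψ φ) :=
  .mp h (conj_imp_iff.1 (.base (.a2 φ ψ)))

theorem refl (φ : Formula) : Derives L Γ (imp φ φ) :=
  -- The theorem `⊥ → φ` serves only as a provable premise to be detached from `(⊥ → φ) → (φ → φ)`.
  .mp (.base (.a9 φ)) (exchange (conj_imp_iff.1 (.base (.a2 φ (imp bot φ)))))

theorem top_intro : Derives L Γ Formula.top := .refl bot

theorem conj_mono_left (h : Derives L Γ (imp φ ψ)) (χ : Formula) :
    Derives L Γ (imp (conj φ χ) (conj ψ χ)) :=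
  conj_imp_iff.2 (h.trans (conj_imp_iff.1 (refl _)))

theorem conj_mono (h : Derives L Γ (imp φ ψ)) (h' : Derives L Γ (imp χ ξ)) :
    Derives L Γ (imp (conj φ χ) (conj ψ ξ)) :=
  (conj_mono_left h χ).trans <| (Derives.base (.a3 _ _)).trans <|
    (conj_mono_left h' ψ).trans <| .base (.a3 _ _)

theorem modus_ponens_imp (φ ψ : Formula) : Derives L Γ (imp (conj (imp φ ψ) φ) ψ) :=
  conj_imp_iff.2 (refl _)

theorem imp_mono (h : Derives L Γ (imp ψ φ)) (h' : Derives L Γ (imp χ ξ)) :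
    Derives L Γ (imp (imp φ χ) (imp ψ ξ)) :=
  conj_imp_iff.1 ((conj_mono (refl _) h).trans ((modus_ponens_imp φ χ).trans h'))

theorem conj_assoc_imp : Derives L Γ (imp (conj (conj φ ψ) χ) (conj φ (conj ψ χ))) :=
  conj_imp_iff.2 (conj_imp_iff.2 ((conj_imp_iff.1 (refl _)).trans (.base (.a7b _ _ _))))

theorem conj_assoc_imp' : Derives L Γ (imp (conj φ (conj ψ χ)) (conj (conj φ ψ) χ)) :=
  conj_imp_iff.2 ((conj_imp_iff.1 (conj_imp_iff.1 (refl _))).trans (.base (.a7a _ _ _)))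

/-- Proof by cases on the order of two formulas. -/
theorem cases (φ ψ : Formula) (h : Derives L Γ (imp (imp φ ψ) χ))
    (h' : Derives L Γ (imp (imp ψ φ) χ)) : Derives L Γ χ :=
  .mp h' (.mp h (.base (.a8 φ ψ χ)))

theorem meet_imp_left : Derives L Γ (imp (meet φ ψ) φ) := .base (.a4 φ ψ)

theorem meet_imp_right : Derives L Γ (imp (meet φ ψ) ψ) :=
  (Derives.base (.a5 φ ψ)).trans meet_imp_left

/-- Prelinearity splits into cases; under `φ → ψ`, the axiom `(φ & (φ → ψ)) → (ψ ∧ φ)` turns `φ`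
alone into the meet. -/
theorem imp_meet (h : Derives L Γ (imp χ φ)) (h' : Derives L Γ (imp χ ψ)) :
    Derives L Γ (imp χ (meet φ ψ)) := by
  refine cases φ ψ (conj_imp_iff.1 ?_) (conj_imp_iff.1 ?_)
  · exact (conj_mono (refl _) h).trans <| (Derives.base (.a3 _ _)).trans <|
      (Derives.base (.a6 _ _)).trans (.base (.a5 _ _))
  · exact (conj_mono (refl _) h').trans <| (Derives.base (.a3 _ _)).trans <| .base (.a6 _ _)

/-- The definable lattice disjunction. -/
def _root_.MTL.Formula.join (φ ψ : Formula) : Formula :=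
  meet (imp (imp φ ψ) ψ) (imp (imp ψ φ) φ)

theorem imp_join_left : Derives L Γ (imp φ (join φ ψ)) :=
  imp_meet (exchange (refl _)) (conj_imp_iff.1 (.base (.a2 _ _)))

theorem imp_join_right : Derives L Γ (imp ψ (join φ ψ)) :=
  imp_meet (conj_imp_iff.1 (.base (.a2 _ _))) (exchange (refl _))

theorem join_imp (h : Derives L Γ (imp φ χ)) (h' : Derives L Γ (imp ψ χ)) :
    Derives L Γ (imp (join φ ψ) χ) :=
  cases φ ψ (exchange (meet_imp_left.trans (imp_mono (refl _) h')))
    (exchange (meet_imp_right.trans (imp_mono (refl _) h)))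

end Derives

/-! ### Lindenbaum algebras -/

/-- Interderivability of formulas over `Γ`. -/
def lindenbaumSetoid (L : Extension) (Γ : Set Formula) : Setoid (ULift.{u} Formula) where
  r φ ψ := Derives L Γ (imp φ.down ψ.down) ∧ Derives L Γ (imp ψ.down φ.down)
  iseqv := ⟨fun _ => ⟨.refl _, .refl _⟩, fun h => ⟨h.2, h.1⟩,
    fun h h' => ⟨h.1.trans h'.1, h'.2.trans h.2⟩⟩

/-- The algebra of formulas modulo interderivability over `Γ`. -/
def Lindenbaum (L : Extension) (Γ : Set Formula) : Type u := Quotient (lindenbaumSetoid.{u} L Γ)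

namespace Lindenbaum

variable {L : Extension} {Γ : Set Formula}

/-- The class of a formula. -/
def mk (L : Extension) (Γ : Set Formula) (φ : Formula) : Lindenbaum.{u} L Γ :=
  Quotient.mk (lindenbaumSetoid L Γ) ⟨φ⟩

theorem mk_surjective : Function.Surjective (mk.{u} L Γ) := by
  rintro ⟨⟨φ⟩⟩
  exact ⟨φ, rfl⟩

theorem mk_eq_mk {φ ψ : Formula} : mk.{u} L Γ φ = mk L Γ ψ ↔
    Derives L Γ (imp φ ψ) ∧ Derives L Γ (imp ψ φ) :=
  Quotient.eq (r := lindenbaumSetoid.{u} L Γ)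

/-- Lifting of a binary connective to classes. -/
def map₂ (f : Formula → Formula → Formula)
    (hf : ∀ {φ ψ χ ξ}, Derives L Γ (imp φ ψ) → Derives L Γ (imp ψ φ) → Derives L Γ (imp χ ξ) →
      Derives L Γ (imp ξ χ) → Derives L Γ (imp (f φ χ) (f ψ ξ))) :
    Lindenbaum.{u} L Γ → Lindenbaum.{u} L Γ → Lindenbaum.{u} L Γ :=
  Quotient.map₂ (fun φ ψ => ⟨f φ.down ψ.down⟩)
    fun _ _ h _ _ h' => ⟨hf h.1 h.2 h'.1 h'.2, hf h.2 h.1 h'.2 h'.1⟩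

instance : LE (Lindenbaum.{u} L Γ) where
  le := Quotient.lift₂ (fun φ ψ => Derives L Γ (imp φ.down ψ.down))
    fun _ _ _ _ h h' => propext
      ⟨fun H => h.2.trans (H.trans h'.1), fun H => h.1.trans (H.trans h'.2)⟩

theorem mk_le_mk {φ ψ : Formula} : mk.{u} L Γ φ ≤ mk L Γ ψ ↔ Derives L Γ (imp φ ψ) := Iff.rfl

instance : PartialOrder (Lindenbaum.{u} L Γ) where
  le_refl := mk_surjective.forall.2 fun φ => Derives.refl φ
  le_trans := mk_surjective.forall₃.2 fun _ _ _ => Derives.trans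
  le_antisymm := mk_surjective.forall₂.2 fun _ _ h h' => mk_eq_mk.2 ⟨h, h'⟩

instance : Lattice (Lindenbaum.{u} L Γ) where
  inf := map₂ meet fun h _ h' _ =>
    .imp_meet (Derives.meet_imp_left.trans h) (Derives.meet_imp_right.trans h')
  sup := map₂ join fun h _ h' _ =>
    .join_imp (h.trans Derives.imp_join_left) (h'.trans Derives.imp_join_right)
  inf_le_left := mk_surjective.forall₂.2 fun _ _ => Derives.meet_imp_left
  inf_le_right := mk_surjective.forall₂.2 fun _ _ => Derives.meet_imp_right
  le_inf := mk_surjective.forall₃.2 fun _ _ _ => Derives.imp_meet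
  le_sup_left := mk_surjective.forall₂.2 fun _ _ => Derives.imp_join_left
  le_sup_right := mk_surjective.forall₂.2 fun _ _ => Derives.imp_join_right
  sup_le := mk_surjective.forall₃.2 fun _ _ _ => Derives.join_imp

instance : BoundedOrder (Lindenbaum.{u} L Γ) where
  top := mk L Γ Formula.top
  bot := mk L Γ bot
  le_top := mk_surjective.forall.2 fun _ => Derives.weaken .top_intro
  bot_le := mk_surjective.forall.2 fun φ => Derives.base (.a9 φ)

instance : CommMonoid (Lindenbaum.{u} L Γ) where
  mul := map₂ conj fun h _ h' _ => .conj_mono h h'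
  one := mk L Γ Formula.top
  mul_assoc := mk_surjective.forall₃.2 fun _ _ _ =>
    mk_eq_mk.2 ⟨.conj_assoc_imp, .conj_assoc_imp'⟩
  one_mul := mk_surjective.forall.2 fun _ => mk_eq_mk.2
    ⟨(Derives.base (.a3 _ _)).trans (.base (.a2 _ _)),
      .mp .top_intro (Derives.conj_imp_iff.1 (.refl _))⟩
  mul_one := mk_surjective.forall.2 fun _ => mk_eq_mk.2
    ⟨.base (.a2 _ _), .mp .top_intro (Derives.exchange (Derives.conj_imp_iff.1 (.refl _)))⟩
  mul_comm := mk_surjective.forall₂.2 fun _ _ => mk_eq_mk.2 ⟨.base (.a3 _ _), .base (.a3 _ _)⟩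

instance : HImp (Lindenbaum.{u} L Γ) where
  himp := map₂ imp fun _ h h' _ => .imp_mono h h'

theorem mk_eq_one {φ : Formula} : mk.{u} L Γ φ = 1 ↔ Derives L Γ φ :=
  (mk_eq_mk (ψ := Formula.top)).trans
    ⟨fun h => .mp .top_intro h.2, fun h => ⟨.weaken .top_intro, .weaken h⟩⟩

instance : MTLAlgebra (Lindenbaum.{u} L Γ) where
  top_eq_one := rfl
  residuation := mk_surjective.forall₃.2 fun _ _ _ => Derives.conj_imp_iff
  prelinearity := mk_surjective.forall₂.2 fun φ ψ =>
    mk_eq_one.2 (.cases φ ψ .imp_join_left .imp_join_right)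

/-- Assignments into a Lindenbaum algebra are substitutions, up to the choice of representatives. -/
theorem eval_mk (σ : ℕ → Formula) (φ : Formula) :
    eval (fun i => mk.{u} L Γ (σ i)) φ = mk L Γ (φ.subst σ) := by
  induction φ with
  | var i => rfl
  | bot => rfl
  | conj φ ψ h h' => rw [eval, h, h']; rfl
  | meet φ ψ h h' => rw [eval, h, h']; rfl
  | imp φ ψ h h' => rw [eval, h, h']; rfl

theorem valid_iff {φ : Formula} :
    Valid (Lindenbaum.{u} L Γ) φ ↔ ∀ σ : ℕ → Formula, Derives L Γ (φ.subst σ) := by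
  refine ⟨fun h σ => ?_, fun h e => ?_⟩
  · rw [← mk_eq_one.{u}, ← eval_mk]
    exact h _
  · choose σ hσ using fun i => mk_surjective (e i)
    rw [← funext hσ, eval_mk]
    exact mk_eq_one.2 (h σ)

theorem isAlgebraOf : IsAlgebraOf L (Lindenbaum.{u} L Γ) :=
  fun _ hφ => valid_iff.2 fun σ => .scheme σ hφ

/-- If `Γ` is maximal among the theories from which `φ` is not derivable, its Lindenbaum algebra
is subdirectly irreducible. -/
theorem subdirectlyIrreducible {φ : Formula}
    (hΓ : Maximal (fun Δ => ¬ Derives L Δ φ) Γ) : SubdirectlyIrreducible (Lindenbaum.{u} L Γ) := by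
  refine subdirectlyIrreducible_of_forall_rel_one (a := mk L Γ φ)
    (fun h => hΓ.prop (mk_eq_one.1 h)) fun θ hθ => ?_
  have hrefl : ∀ {ψ}, Derives L Γ ψ → θ.r (mk L Γ ψ) 1 := fun h =>
    mk_eq_one.2 h ▸ θ.iseqv.refl _
  -- The formulas identified with `1` form a deductively closed theory containing `Γ`.
  have hclosed : ∀ {ψ}, Derives L {ψ | θ.r (mk L Γ ψ) 1} ψ → θ.r (mk L Γ ψ) 1 := by
    intro ψ h
    induction h with
    | hyp h => exact h
    | base h => exact hrefl (.base h)
    | scheme σ h => exact hrefl (.scheme σ h)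
    | @mp χ ξ _ _ h h' =>
      have := θ.himp h (θ.iseqv.refl (mk L Γ ξ))
      rw [one_himp'] at this
      exact θ.iseqv.trans (θ.iseqv.symm this) h'
  refine hclosed (not_not.1 fun hφ => ?_)
  -- Were `φ` outside that theory, maximality would put the theory inside `Γ`; but it contains a
  -- formula whose class is not `1`.
  obtain ⟨z, hz, hz1⟩ := hθ.exists_rel_one
  obtain ⟨ψ, rfl⟩ := mk_surjective z
  exact hz (mk_eq_one.2 (.hyp (hΓ.le_of_ge hφ (fun _ h => hrefl (.hyp h)) hz1)))

end Lindenbaum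

/-! ### Maximal theories; completeness and genericity -/

theorem exists_maximal_not_derives {L : Extension} {Γ : Set Formula} {φ : Formula}
    (h : ¬ Derives L Γ φ) : ∃ Δ, Γ ⊆ Δ ∧ Maximal (fun Δ => ¬ Derives L Δ φ) Δ := by
  refine zorn_subset_nonempty {Δ | ¬ Derives L Δ φ} (fun c hcS hc hne => ?_) Γ h
  refine ⟨⋃₀ c, fun H => ?_, fun _ => Set.subset_sUnion_of_mem⟩
  obtain ⟨S, hS, H⟩ := H.exists_mem_of_sUnion hne hc.directedOn
  exact hcS hS H

theorem isGeneric_of_completeWrt {L : Extension} {A : Type u} [MTLAlgebra A]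
    (hA : CompleteWrt L A) (hAL : IsAlgebraOf L A) : IsGeneric L A := by
  intro B _
  refine ⟨fun h φ hφ e => ?_, fun h φ ψ hφψ e => ?_⟩
  · rw [h φ Formula.top (fun e => (hAL φ hφ e).trans (eval_top e).symm) e, eval_top]
  · have h1 : Provable L (imp φ ψ) := (hA _).2 fun e => himp_eq_one_iff.2 (hφψ e).le
    have h2 : Provable L (imp ψ φ) := (hA _).2 fun e => himp_eq_one_iff.2 (hφψ e).ge
    exact le_antisymm (himp_eq_one_iff.1 (h1.valid h e)) (himp_eq_one_iff.1 (h2.valid h e))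

/-- Genericity transfers `φ ≈ ⊤` from `A` to the Lindenbaum algebra of the empty theory, where the
identity substitution reads it as provability. -/
theorem IsGeneric.completeWrt {L : Extension} {A : Type u} [MTLAlgebra A]
    (hA : IsGeneric L A) (hAL : IsAlgebraOf L A) : CompleteWrt L A := by
  refine fun φ => ⟨fun h => h.valid hAL, fun h => ?_⟩
  have := (hA (Lindenbaum.{u} L ∅)).2 Lindenbaum.isAlgebraOf φ Formula.top
    fun e => (h e).trans (eval_top e).symm
  have hv : ∀ φ : Formula, φ.subst var = φ := by
    intro φ
    induction φ <;> simp_all [subst]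
  rw [← hv φ]
  exact Lindenbaum.valid_iff.{u}.1 (fun e => (this e).trans (eval_top e)) var

/-! ### Copies of formulas in disjoint variables -/

/-- Gödel numbering of formulas. -/
def Formula.code : Formula → ℕ
  | var i => Nat.pair 0 i
  | bot => Nat.pair 1 0
  | conj φ ψ => Nat.pair 2 (Nat.pair φ.code ψ.code)
  | meet φ ψ => Nat.pair 3 (Nat.pair φ.code ψ.code)
  | imp φ ψ => Nat.pair 4 (Nat.pair φ.code ψ.code)

theorem Formula.code_injective : Function.Injective Formula.code := by
  intro φ
  induction φ with
  | var i => intro ψ h; cases ψ <;> simp_all [Formula.code]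
  | bot => intro ψ h; cases ψ <;> simp_all [Formula.code]
  | conj φ φ' ih ih' =>
    intro ψ h
    cases ψ <;> simp [Formula.code] at h
    rw [ih h.1, ih' h.2]
  | meet φ φ' ih ih' =>
    intro ψ h
    cases ψ <;> simp [Formula.code] at h
    rw [ih h.1, ih' h.2]
  | imp φ φ' ih ih' =>
    intro ψ h
    cases ψ <;> simp [Formula.code] at h
    rw [ih h.1, ih' h.2]

/-- Renaming of the variables such that distinct formulas get disjoint sets of variables, none of
them containing the variable with index `0`. -/
def Formula.freshVar (φ : Formula) (i : ℕ) : Formula := var (Nat.pair φ.code i + 1)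

instance : Nonempty Formula := ⟨bot⟩

/-- The assignment that acts as `E φ` on the fresh variables of `φ`, and takes the value `c` at the
variable with index `0`. -/
noncomputable def jointAssignment {A : Type u} (c : A) (E : Formula → ℕ → A) : ℕ → A
  | 0 => c
  | k + 1 =>
    E (Function.invFun Formula.code k.unpair.1) k.unpair.2

/-- Since the copies share no variables, one assignment realizes all the `E φ` simultaneously. -/
theorem eval_jointAssignment {A : Type u} [MTLAlgebra A] (c : A) (E : Formula → ℕ → A)
    (φ : Formula) : eval (jointAssignment c E) (φ.subst φ.freshVar) = eval (E φ) φ := by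
  rw [eval_subst]
  congr 1
  funext i
  simp [Formula.freshVar, eval, jointAssignment, Function.leftInverse_invFun code_injective φ]

/-- In a nontrivial chain, finitely many elements below `1` have an upper bound below `1`. -/
theorem IsChain.exists_upper_bound_ne_one {A : Type u} [MTLAlgebra A] (hA : IsChain A)
    (hbot : (⊥ : A) ≠ 1) {S : Set A} (hS : S.Finite) (h : ∀ a ∈ S, a ≠ 1) :
    ∃ c : A, c ≠ 1 ∧ ∀ a ∈ S, a ≤ c := by
  induction S, hS using Set.Finite.induction_on with
  | empty => exact ⟨⊥, hbot, fun _ h => h.elim⟩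
  | @insert a S _ _ ih =>
    obtain ⟨c, hc, hcS⟩ := ih fun b hb => h b (Set.mem_insert_of_mem a hb)
    rcases hA a c with hac | hca
    · exact ⟨c, hc, Set.forall_mem_insert.2 ⟨hac, hcS⟩⟩
    · exact ⟨a, h a (Set.mem_insert a S),
        Set.forall_mem_insert.2 ⟨le_rfl, fun b hb => (hcS b hb).trans hca⟩⟩

/-! ### Single chain completeness -/

/-- Fresh copies of all unprovable formulas can be put below a common variable without making it
derivable. -/
theorem not_derives_var_zero {L : Extension} {A : Type u} [MTLAlgebra A]
    (hAL : IsAlgebraOf L A) (hchain : IsChain A) (hA : CompleteWrt L A)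
    (hL : ¬ Provable L (var 0)) :
    ¬ Derives L ((fun φ => imp (φ.subst φ.freshVar) (var 0)) '' {φ | ¬ Provable L φ}) (var 0) := by
  intro h
  obtain ⟨S, hSΓ, hS, h⟩ := h.exists_finite
  obtain ⟨F, hFΓ, hF, rfl⟩ := Set.exists_subset_image_finite_and.1 ⟨S, hSΓ, hS, rfl⟩
  have hE : ∀ φ : Formula, ∃ e : ℕ → A, ¬ Provable L φ → eval e φ ≠ 1 := by
    intro φ
    by_cases hφ : Provable L φ
    · exact ⟨fun _ => 1, fun h => (h hφ).elim⟩
    · rw [hA, Valid] at hφ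
      push Not at hφ
      exact hφ.imp fun e he _ => he
  choose E hE using hE
  -- In a trivial algebra `var 0` would be valid, hence provable.
  have hbot : (⊥ : A) ≠ 1 := fun hb =>
    hL ((hA _).2 fun e => le_antisymm (le_one' _) (hb ▸ bot_le))
  obtain ⟨c, hc, hcF⟩ := hchain.exists_upper_bound_ne_one hbot
    (hF.image fun φ => eval (E φ) φ) (Set.forall_mem_image.2 fun φ hφ => hE φ (hFΓ hφ))
  refine hc (h.eval_eq_one hAL (e := jointAssignment c E) (Set.forall_mem_image.2 ?_))
  intro φ hφ
  rw [eval, himp_eq_one_iff, eval_jointAssignment]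
  exact hcF _ (Set.mem_image_of_mem _ hφ)

theorem SCC.subSCC {L : Extension} (h : SCC.{u} L) : SubSCC.{v} L := by
  obtain ⟨A, _, hAL, hchain, hA⟩ := h
  -- A provable variable means that `L` is inconsistent; the trivial algebra is then generic.
  by_cases hL : Provable L (var 0)
  · have hall : ∀ φ, Provable L φ := fun φ => (hA φ).2 fun e =>
      (hA _).1 hL fun _ => eval e φ
    have hone : ∀ x : Lindenbaum.{v} L ∅, x = 1 :=
      Lindenbaum.mk_surjective.forall.2 fun φ => Lindenbaum.mk_eq_one.2 (hall φ)
    exact ⟨Lindenbaum L ∅, inferInstance, Lindenbaum.isAlgebraOf,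
      Or.inl ⟨fun x y => (hone x).trans (hone y).symm⟩,
      isGeneric_of_completeWrt (fun φ => ⟨fun _ e => hone _, fun _ => hall φ⟩)
        Lindenbaum.isAlgebraOf⟩
  · obtain ⟨Δ, hΔ, hmax⟩ := exists_maximal_not_derives (not_derives_var_zero hAL hchain hA hL)
    refine ⟨Lindenbaum L Δ, inferInstance, Lindenbaum.isAlgebraOf,
      Lindenbaum.subdirectlyIrreducible hmax,
      isGeneric_of_completeWrt (fun φ => ⟨fun h => h.valid Lindenbaum.isAlgebraOf, fun h => ?_⟩)
        Lindenbaum.isAlgebraOf⟩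
    by_contra hφ
    exact hmax.prop (.mp (Lindenbaum.valid_iff.1 h φ.freshVar)
      (.hyp (hΔ (Set.mem_image_of_mem _ hφ))))

/-- `A` is itself a complete chain, but in universe `v`. The Lindenbaum algebra of the theory of `e`
is a copy, in universe `u`, of the subalgebra generated by the values of `e`, which already refutes
every unprovable formula. -/
theorem SubSCC.scc {L : Extension} (h : SubSCC.{v} L) : SCC.{u} L := by
  obtain ⟨A, _, hAL, hsi, hgen⟩ := h
  have hA := hgen.completeWrt hAL
  have hE : ∀ φ : Formula, ∃ e : ℕ → A, eval e φ = 1 → Provable L φ := by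
    intro φ
    by_contra! H
    exact (H fun _ => 1).2 ((hA φ).2 fun e => (H e).1)
  choose E hE using hE
  -- The value `1` at `var 0` is arbitrary: no fresh copy contains that variable.
  set e := jointAssignment 1 E
  have hT : ∀ {φ}, Derives L {φ | eval e φ = 1} φ ↔ eval e φ = 1 :=
    ⟨fun h => h.eval_eq_one hAL fun _ hφ => hφ, fun h => .hyp h⟩
  refine ⟨Lindenbaum L {φ | eval e φ = 1}, inferInstance, Lindenbaum.isAlgebraOf,
    Lindenbaum.mk_surjective.forall₂.2 fun φ ψ => ?_,
    fun φ => ⟨fun h => h.valid Lindenbaum.isAlgebraOf, fun h => hE φ ?_⟩⟩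
  · rw [Lindenbaum.mk_le_mk, Lindenbaum.mk_le_mk, hT, hT, eval, eval, himp_eq_one_iff,
      himp_eq_one_iff]
    exact hsi.isChain _ _
  · rw [← eval_jointAssignment 1 E φ]
    exact hT.1 (Lindenbaum.valid_iff.1 h φ.freshVar)

end MTL

theorem mainTheorem3 (L : MTL.Extension) (n : ℕ) (hn : 0 < n) (hL : MTL.Contractive L n) :
    MTL.SCC.{u} L ↔ MTL.SubSCC.{v} L :=
  ⟨MTL.SCC.subSCC, MTL.SubSCC.scc⟩
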